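/- For $c>0$ let $K(x,y)=\exp(-\|x-y\|_1/c)$ be the Laplacian kernel on $\mathbb{R}^d$. A feature map of $K$ is a map $\varphi:\mathbb{R}^d\to\mathcal H$ into a real Hilbert space with $\langle\varphi(x),\varphi(y)\rangle=K(x,y)$ for all $x,y$; put $\mathrm{dist}_\varphi(x,y)=\|\varphi(x)-\varphi(y)\|$. For $N\in\mathbb{N}$ let $\pi_1^{(d)}:\mathbb{R}^d\to\mathbb{R}^{dN}$ be the unary embedding: the $j$-th entry ($1\le j\le N$) of the $i$-th block of $\pi_1^{(d)}(x)$ is $1$ if $j\le x_i$ and $0$ otherwise. Let $\phi:\mathbb{R}^{dN}\to\mathbb{R}^{2D}$ be the random Fourier feature map with $D$ frequencies for the Gaussian kernel $K'(z)=\exp(-\|z\|_2^2/c)$, i.e. $\phi(z)=\sqrt{1/D}\,\bigl(\sin\langle\omega_k,z\rangle,\cos\langle\omega_k,z\rangle\bigr)_{k=1}^{D}$, where $\omega_1,\dots,\omega_D$ are i.i.d. with density $p(\omega)=(2\pi)^{-dN}\int_{\mathbb{R}^{dN}}K'(z)e^{-\mathrm i\langle\omega,z\rangle}\,\mathrm dz$.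 Let $\pi=\phi\circ\pi_1^{(d)}$ and $\mathrm{dist}_\pi(x,y)=\|\pi(x)-\pi(y)\|_2$. Theorem. There is an absolute constant $C>0$ such that for all $c>0$, all $0<\delta\le\varepsilon\le 2^{-16}$ and all $d,D,N\in\mathbb{N}$ with $$D\ \ge\ \max\{C\varepsilon^{-1}\log^3(1/\delta),\ C\varepsilon^{-2}\log(1/\delta)\},$$ the following hold. (1) The density $p$ is a probability density, so that $\pi$ is a well-defined random map, and $\|\pi_1^{(d)}(x)-\pi_1^{(d)}(y)\|_2^2=\|x-y\|_1$ for all $x,y\in\{0,\dots,N\}^d$. (2) For every feature map $\varphi$ of $K$ and all $x,y\in\{0,\dots,N\}^d$, $$\Pr\bigl[\,|\mathrm{dist}_\pi(x,y)-\mathrm{dist}_\varphi(x,y)|\le\varepsilon\cdot\mathrm{dist}_\varphi(x,y)\,\bigr]\ \ge\ 1-\delta .$$ (3) $\pi$ can be evaluated in time $\tilde O(dDN)$: there are a single program for the real random access machine (exact real arithmetic, with field operations, square root, sine, cosine and comparisons of reals, and integer counters and addresses, at unit cost per instruction) and constants $A,a$, all independent of the parameters, such that if $d,N\ge1$ then on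 input $d,D,N$, a point $x\in\mathbb{R}^d$ and any realization of the frequencies $\omega_1,\dots,\omega_D$, the program outputs $\pi(x)$ after at most $A\cdot dDN\cdot(1+\log(dDN))^{a}$ steps. -/

import Mathlib

/-! ### Kernels and feature maps -/

/-- The Laplacian kernel `exp (-‖x - y‖₁ / c)` on `ℝ^d`. -/
noncomputable def laplacianKernel (c : ℝ) {d : ℕ} (x y : Fin d → ℝ) : ℝ :=
  Real.exp (-(∑ i, |x i - y i|) / c)

/-- `φ` is a feature map of the kernel `K`: its inner products reproduce `K`. -/
def IsFeatureMap {X H : Type*} [NormedAddCommGroup H] [InnerProductSpace ℝ H]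
    (K : X → X → ℝ) (φ : X → H) : Prop :=
  ∀ x y, inner ℝ (φ x) (φ y) = K x y

/-- The Gaussian kernel `exp (-‖z‖₂² / c)`, as a function of the difference `z` of two points. -/
noncomputable def gaussianKernel (c : ℝ) (ι : Type*) [Fintype ι] (z : EuclideanSpace ℝ ι) : ℝ :=
  Real.exp (-‖z‖ ^ 2 / c)

/-! ### Random Fourier features of a shift-invariant kernel -/

section RFF

variable {ι : Type*} [Fintype ι]

/-- The Fourier transform `(2π)⁻ⁿ ∫ K(z) e^{-i⟨ω, z⟩} dz` of a shift-invariant kernel on `ℝⁿ`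
(its real part; it is real for an even function `K`). -/
noncomputable def rffDensity (K : EuclideanSpace ℝ ι → ℝ) (ω : EuclideanSpace ℝ ι) : ℝ :=
  ((2 * Real.pi) ^ Fintype.card ι)⁻¹ *
    (∫ z : EuclideanSpace ℝ ι, (K z : ℂ) * Complex.exp (-Complex.I * (inner ℝ ω z : ℝ))).re

/-- The distribution of one random frequency: it has the density `rffDensity K`. -/
noncomputable def rffMeasure (K : EuclideanSpace ℝ ι → ℝ) :
    MeasureTheory.Measure (EuclideanSpace ℝ ι) :=
  MeasureTheory.volume.withDensity fun ω => ENNReal.ofReal (rffDensity K ω)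

/-- The joint distribution of `D` independent random frequencies. -/
noncomputable def rffLaw (K : EuclideanSpace ℝ ι → ℝ) (D : ℕ) :
    MeasureTheory.Measure (Fin D → EuclideanSpace ℝ ι) :=
  MeasureTheory.Measure.pi fun _ => rffMeasure K

/-- The random Fourier feature map with frequencies `ω 0, …, ω (D - 1)`. Its coordinates are
`√(1/D) sin ⟨ω k, z⟩` and `√(1/D) cos ⟨ω k, z⟩`, in positions `(k, 0)` and `(k, 1)`. -/
noncomputable def rffMap {D : ℕ} (ω : Fin D → EuclideanSpace ℝ ι) (z : EuclideanSpace ℝ ι) :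
    EuclideanSpace ℝ (Fin D × Fin 2) :=
  WithLp.toLp 2 fun p =>
    Real.sqrt (1 / D) *
      if p.2 = 0 then Real.sin (inner ℝ (ω p.1) z) else Real.cos (inner ℝ (ω p.1) z)

end RFF

/-! ### The unary embedding and the composed map -/

/-- The concatenation of the unary codes of the `d` coordinates: position `j ∈ {1, …, N}` of the
`i`-th block is `1` if `j ≤ x i`, and `0` otherwise (here `j` is counted from `0`). -/
noncomputable def unaryEmbedding {d : ℕ} (N : ℕ) (x : Fin d → ℝ) :
    EuclideanSpace ℝ (Fin d × Fin N) :=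
  WithLp.toLp 2 fun p => if ((p.2 : ℕ) : ℝ) + 1 ≤ x p.1 then 1 else 0

/-- The unary embedding followed by the random Fourier feature map with frequencies `ω`. -/
noncomputable def laplacianMap {d D N : ℕ} (ω : Fin D → EuclideanSpace ℝ (Fin d × Fin N))
    (x : Fin d → ℝ) : EuclideanSpace ℝ (Fin D × Fin 2) :=
  rffMap ω (unaryEmbedding N x)

/-! ### A real random access machine

Natural-number registers (used as counters and addresses) can only be set to a constant, copied,
incremented and compared, so that in `t` steps they grow by at most `t` beyond the inputs and the
constants of the program. Real registers admit the field operations, square roots, sine, cosine and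
comparisons. Real arrays are accessed through addresses held in natural-number registers. Every
instruction and every test takes one step. -/

namespace RealRAM

structure State where
  nat : ℕ → ℕ
  real : ℕ → ℝ
  arr : ℕ → ℕ → ℝ

/-- The first argument of an instruction is its destination, except for `store a i r`, which writes
real register `r` to cell `nat i` of array `a`; `load r a i` reads that cell. -/
inductive Instr where
  | natConst (i n : ℕ)
  | natCopy (i j : ℕ)
  | natSucc (i : ℕ)
  | realConst (r n : ℕ)
  | realCopy (r p : ℕ)
  | realAdd (r p q : ℕ)
  | realSub (r p q : ℕ)
  | realMul (r p q : ℕ)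
  | realDiv (r p q : ℕ)
  | realSqrt (r p : ℕ)
  | realSin (r p : ℕ)
  | realCos (r p : ℕ)
  | load (r a i : ℕ)
  | store (a i r : ℕ)

namespace State

def setNat (s : State) (i v : ℕ) : State := { s with nat := Function.update s.nat i v }

noncomputable def setReal (s : State) (r : ℕ) (v : ℝ) : State :=
  { s with real := Function.update s.real r v }

noncomputable def setArr (s : State) (a m : ℕ) (v : ℝ) : State :=
  { s with arr := Function.update s.arr a (Function.update (s.arr a) m v) }

end State

/-- The effect of one instruction. -/
noncomputable def Instr.apply : Instr → State → State
  | natConst i n, s => s.setNat i n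
  | natCopy i j, s => s.setNat i (s.nat j)
  | natSucc i, s => s.setNat i (s.nat i + 1)
  | realConst r n, s => s.setReal r n
  | realCopy r p, s => s.setReal r (s.real p)
  | realAdd r p q, s => s.setReal r (s.real p + s.real q)
  | realSub r p q, s => s.setReal r (s.real p - s.real q)
  | realMul r p q, s => s.setReal r (s.real p * s.real q)
  | realDiv r p q, s => s.setReal r (s.real p / s.real q)
  | realSqrt r p, s => s.setReal r (Real.sqrt (s.real p))
  | realSin r p, s => s.setReal r (Real.sin (s.real p))
  | realCos r p, s => s.setReal r (Real.cos (s.real p))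
  | load r a i, s => s.setReal r (s.arr a (s.nat i))
  | store a i r, s => s.setArr a (s.nat i) (s.real r)

inductive Test where
  | natLt (i j : ℕ)
  | realLe (r p : ℕ)

def Test.Holds : Test → State → Prop
  | natLt i j, s => s.nat i < s.nat j
  | realLe r p, s => s.real r ≤ s.real p

/-- Programs. -/
inductive Cmd where
  | nop
  | instr (I : Instr)
  | seq (P Q : Cmd)
  | cond (b : Test) (P Q : Cmd)
  | loop (b : Test) (P : Cmd)

/-- `Exec P s t s'`: started in `s`, the program `P` halts in the state `s'` after exactly `t`
steps. -/
inductive Exec : Cmd → State → ℕ → State → Prop where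
  | nop (s : State) : Exec .nop s 1 s
  | instr (I : Instr) (s : State) : Exec (.instr I) s 1 (I.apply s)
  | seq {P Q : Cmd} {s s' s'' : State} {t t' : ℕ} (hP : Exec P s t s') (hQ : Exec Q s' t' s'') :
      Exec (.seq P Q) s (t + t') s''
  | condTrue {b : Test} {P Q : Cmd} {s s' : State} {t : ℕ} (hb : b.Holds s)
      (hP : Exec P s t s') : Exec (.cond b P Q) s (t + 1) s'
  | condFalse {b : Test} {P Q : Cmd} {s s' : State} {t : ℕ} (hb : ¬ b.Holds s)
      (hQ : Exec Q s t s') : Exec (.cond b P Q) s (t + 1) s'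
  | loopFalse {b : Test} {P : Cmd} {s : State} (hb : ¬ b.Holds s) : Exec (.loop b P) s 1 s
  | loopTrue {b : Test} {P : Cmd} {s s' s'' : State} {t t' : ℕ} (hb : b.Holds s)
      (hP : Exec P s t s') (hL : Exec (.loop b P) s' t' s'') :
      Exec (.loop b P) s (t + t' + 1) s''

end RealRAM

/-- The state `s` holds the evaluation problem: registers 0, 1, 2 contain `d`, `D`, `N`, array 0
contains the point `x`, and array 1 contains the frequencies in row-major order. All other
registers and cells are arbitrary. -/
def IsInputState {d D N : ℕ} (ω : Fin D → EuclideanSpace ℝ (Fin d × Fin N)) (x : Fin d → ℝ)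
    (s : RealRAM.State) : Prop :=
  s.nat 0 = d ∧ s.nat 1 = D ∧ s.nat 2 = N ∧
    (∀ i : Fin d, s.arr 0 i = x i) ∧
    ∀ (k : Fin D) (i : Fin d) (j : Fin N), s.arr 1 (((k : ℕ) * d + i) * N + j) = ω k (i, j)

/-- Array 2 of the state `s` contains the vector `v` in its first `2 * D` cells. -/
def IsOutputState {D : ℕ} (v : EuclideanSpace ℝ (Fin D × Fin 2)) (s : RealRAM.State) : Prop :=
  ∀ (k : Fin D) (b : Fin 2), s.arr 2 (2 * (k : ℕ) + b) = v (k, b)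

/-!
The unary embedding turns `‖x - y‖₁` into a squared Euclidean distance, so the Laplacian kernel at
`x, y` is the Gaussian kernel at the difference `z` of the embedded points, and both feature
distances are functions of `z`: the kernel distance squared is `2 (1 - exp (-s))` with
`s = ‖z‖² / c`, and the random one is the average over the frequencies of `2 (1 - cos ⟨ω, z⟩)`.

A frequency of the Gaussian kernel is itself Gaussian. This is read off from its characteristic
function (`charFun_rffMeasure_gaussianKernel`), which also shows that the density has mass `1`;
hence the phase `g = ⟨ω, z⟩` is normal with variance `2 s`, and `1 - cos g` has mean
`1 - exp (-s)`. A *relative* error bound uniform in `s` rests on the observation that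
`(1 - cos g) / (1 - exp (-s)) ≤ 4 + g² / s` (`one_sub_cos_div_le`). The right-hand side is an affine
function of the square of a standard normal variable, so this ratio has an exponential moment
bounded by an absolute constant (`integral_exp_one_sub_cos_inner_le`), and the Chernoff bound for
averages of such variables (`measure_pi_sum_sub_card_le`) gives failure probability
`2 exp (-D ε² / 8192)`. A relative error of the squared distance bounds that of the distance. The
condition `D ≥ C ε⁻² log (1 / δ)` is thus all that is needed of `D`.

The program evaluates the inner products `⟨ω k, z⟩` by three nested loops without storing `z`: a
real counter runs through the positions of a block and is compared with the coordinate of the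
point. Its time is `O(d D N)`, without logarithmic factors (`exists_exec_laplacianProg`).
-/

/-! ### The distribution of the frequencies -/

section Concentration

open MeasureTheory ProbabilityTheory

/-- The density of the frequencies of the Gaussian kernel is itself a Gaussian. -/
theorem rffDensity_gaussianKernel {c : ℝ} (hc : 0 < c) {ι : Type*} [Fintype ι]
    (ω : EuclideanSpace ℝ ι) :
    rffDensity (gaussianKernel c ι) ω =
      ((2 * Real.pi) ^ Fintype.card ι)⁻¹ * (Real.pi * c) ^ (Fintype.card ι / 2 : ℝ) *
        Real.exp (-(c / 4) * ‖ω‖ ^ 2) := by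
  have hb : 0 < ((c⁻¹ : ℝ) : ℂ).re := by simpa using hc
  have h := GaussianFourier.integral_cexp_neg_mul_sq_norm_add_of_euclideanSpace hb (-Complex.I) ω
  have e1 : ∀ z : EuclideanSpace ℝ ι,
      (gaussianKernel c ι z : ℂ) * Complex.exp (-Complex.I * (inner ℝ ω z : ℝ)) =
        Complex.exp (-((c⁻¹ : ℝ) : ℂ) * ‖z‖ ^ 2 + -Complex.I * (inner ℝ ω z : ℝ)) := by
    intro z
    rw [gaussianKernel, Complex.exp_add, Complex.ofReal_exp]
    congr 2
    push_cast
    ring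
  have e2 : ((Real.pi : ℂ) / ((c⁻¹ : ℝ) : ℂ)) ^ (Fintype.card ι / 2 : ℂ) *
      Complex.exp ((-Complex.I) ^ 2 * ‖ω‖ ^ 2 / (4 * ((c⁻¹ : ℝ) : ℂ))) =
      (((Real.pi * c) ^ (Fintype.card ι / 2 : ℝ) * Real.exp (-(c / 4) * ‖ω‖ ^ 2) : ℝ) : ℂ) := by
    rw [Complex.ofReal_mul, Complex.ofReal_cpow (by positivity), Complex.ofReal_exp]
    have hc' : (c : ℂ) ≠ 0 := by exact_mod_cast hc.ne'
    congr 2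
    · push_cast
      field_simp
    · push_cast
      rfl
    · push_cast
      rw [neg_sq, Complex.I_sq]
      field_simp
  rw [rffDensity, integral_congr_ae (Filter.Eventually.of_forall e1), h, e2, Complex.ofReal_re,
    mul_assoc]

theorem charFun_rffMeasure_gaussianKernel {c : ℝ} (hc : 0 < c) {ι : Type*} [Fintype ι]
    (t : EuclideanSpace ℝ ι) :
    charFun (rffMeasure (gaussianKernel c ι)) t = Complex.exp (-(‖t‖ ^ 2 / c : ℝ)) := by
  have hb : 0 < ((c / 4 : ℝ) : ℂ).re := by simpa using hc
  have h := GaussianFourier.integral_cexp_neg_mul_sq_norm_add_of_euclideanSpace hb Complex.I t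
  have hm : Measurable fun ω => ENNReal.ofReal (rffDensity (gaussianKernel c ι) ω) := by
    simp_rw [rffDensity_gaussianKernel hc]
    fun_prop
  have hpos : ∀ ω, 0 ≤ rffDensity (gaussianKernel c ι) ω := fun ω => by
    rw [rffDensity_gaussianKernel hc]; positivity
  have e1 : ∀ ω : EuclideanSpace ℝ ι,
      (ENNReal.ofReal (rffDensity (gaussianKernel c ι) ω)).toReal •
        Complex.exp ((inner ℝ ω t : ℝ) * Complex.I) =
      ((((2 * Real.pi) ^ Fintype.card ι)⁻¹ * (Real.pi * c) ^ (Fintype.card ι / 2 : ℝ) : ℝ) : ℂ) *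
        Complex.exp (-((c / 4 : ℝ) : ℂ) * ‖ω‖ ^ 2 + Complex.I * (inner ℝ t ω : ℝ)) := by
    intro ω
    rw [ENNReal.toReal_ofReal (hpos ω), rffDensity_gaussianKernel hc, Complex.exp_add,
      Complex.real_smul, real_inner_comm, Complex.ofReal_mul, mul_assoc, Complex.ofReal_exp,
      mul_comm Complex.I]
    push_cast
    rfl
  have e2 : ((Real.pi : ℂ) / ((c / 4 : ℝ) : ℂ)) ^ (Fintype.card ι / 2 : ℂ) =
      (((Real.pi / (c / 4)) ^ (Fintype.card ι / 2 : ℝ) : ℝ) : ℂ) := by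
    rw [Complex.ofReal_cpow (by positivity)]
    push_cast
    rfl
  -- the two Gaussian integrals contribute `(π c)^(n/2)` and `(4 π / c)^(n/2)`
  have e3 : ((2 * Real.pi) ^ Fintype.card ι)⁻¹ * (Real.pi * c) ^ (Fintype.card ι / 2 : ℝ) *
      (Real.pi / (c / 4)) ^ (Fintype.card ι / 2 : ℝ) = 1 := by
    have hπ := Real.pi_pos
    rw [mul_assoc, ← Real.mul_rpow (by positivity) (by positivity),
      show Real.pi * c * (Real.pi / (c / 4)) = (2 * Real.pi) ^ (2 : ℝ) by
        rw [Real.rpow_two]; field_simp; ring,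
      ← Real.rpow_mul (by positivity), mul_div_cancel₀ _ (two_ne_zero), Real.rpow_natCast]
    exact inv_mul_cancel₀ (by positivity)
  rw [charFun_apply, rffMeasure, integral_withDensity_eq_integral_toReal_smul hm
    (Filter.Eventually.of_forall fun _ => ENNReal.ofReal_lt_top),
    integral_congr_ae (Filter.Eventually.of_forall e1), integral_const_mul, h, e2, ← mul_assoc,
    ← Complex.ofReal_mul, e3, Complex.ofReal_one, one_mul]
  congr 1
  rw [Complex.I_sq]
  have hc' : (c : ℂ) ≠ 0 := by exact_mod_cast hc.ne'
  push_cast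
  field_simp

theorem isProbabilityMeasure_rffMeasure_gaussianKernel {c : ℝ} (hc : 0 < c) (ι : Type*)
    [Fintype ι] : IsProbabilityMeasure (rffMeasure (gaussianKernel c ι)) := by
  have h := charFun_rffMeasure_gaussianKernel hc (0 : EuclideanSpace ℝ ι)
  rw [charFun_zero] at h
  have h1 : (rffMeasure (gaussianKernel c ι)).real Set.univ = 1 := by simpa using h
  exact ⟨by simpa [Measure.real, ENNReal.toReal_eq_one_iff] using h1⟩

/-- The phase `⟨ω, z⟩` of a random frequency of the Gaussian kernel is normally distributed. -/
theorem map_inner_rffMeasure_gaussianKernel {c : ℝ} (hc : 0 < c) {ι : Type*} [Fintype ι]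
    (z : EuclideanSpace ℝ ι) :
    (rffMeasure (gaussianKernel c ι)).map (fun ω => (inner ℝ ω z : ℝ)) =
      gaussianReal 0 (2 * ‖z‖ ^ 2 / c).toNNReal := by
  have := isProbabilityMeasure_rffMeasure_gaussianKernel hc ι
  have : IsProbabilityMeasure
      ((rffMeasure (gaussianKernel c ι)).map (fun ω => (inner ℝ ω z : ℝ))) :=
    Measure.isProbabilityMeasure_map (by fun_prop)
  refine Measure.ext_of_charFun (funext fun r => ?_)
  have h := charFun_rffMeasure_gaussianKernel hc (r • z)
  rw [charFun_apply] at h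
  rw [charFun_apply, integral_map (by fun_prop) (by fun_prop), charFun_gaussianReal,
    Real.coe_toNNReal _ (by positivity)]
  simp only [inner_smul_right] at h
  simp only [Real.inner_apply, mul_comm _ r]
  refine h.trans ?_
  congr 1
  rw [norm_smul, mul_pow, Real.norm_eq_abs, sq_abs]
  push_cast
  ring

/-! ### Concentration of averages of sub-exponential variables -/

theorem Real.exp_le_one_add_add_sq_mul_exp_abs (u : ℝ) :
    Real.exp u ≤ 1 + u + u ^ 2 * Real.exp |u| := by
  have h := Complex.norm_exp_sub_sum_le_norm_mul_exp (u : ℂ) 2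
  have e : Complex.exp u - ∑ m ∈ Finset.range 2, (u : ℂ) ^ m / (m.factorial : ℂ) =
      ((Real.exp u - (1 + u) : ℝ) : ℂ) := by
    simp [Finset.sum_range_succ]
  rw [e, Complex.norm_real, Complex.norm_real, Real.norm_eq_abs, Real.norm_eq_abs, sq_abs] at h
  linarith [le_abs_self (Real.exp u - (1 + u))]

/-- A nonnegative variable with mean `1` and an exponential moment has, after centering, a
sub-Gaussian moment generating function near `0`. -/
theorem mgf_sub_one_le {Ω : Type*} [MeasurableSpace Ω] {μ : Measure Ω} [IsProbabilityMeasure μ]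
    {Y : Ω → ℝ} (hYm : Measurable Y) (hY0 : ∀ ω, 0 ≤ Y ω)
    (hint : Integrable (fun ω => Real.exp (Y ω / 8)) μ) (hexp : ∫ ω, Real.exp (Y ω / 8) ∂μ ≤ 4)
    (hmean : ∫ ω, Y ω ∂μ = 1) {t : ℝ} (ht : |t| ≤ 1 / 16) :
    Integrable (fun ω => Real.exp (t * (Y ω - 1))) μ ∧
      mgf (fun ω => Y ω - 1) μ t ≤ Real.exp (2048 * t ^ 2) := by
  have hYi : Integrable Y μ := by
    refine (hint.const_mul 8).mono' hYm.aestronglyMeasurable (.of_forall fun ω => ?_)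
    rw [Real.norm_eq_abs, abs_of_nonneg (hY0 ω)]
    linarith [Real.add_one_le_exp (Y ω / 8)]
  have hle : ∀ ω, |t * Y ω| ≤ Y ω / 16 := fun ω => by
    rw [abs_mul, abs_of_nonneg (hY0 ω)]
    nlinarith [hY0 ω]
  have hti : Integrable (fun ω => Real.exp (t * Y ω)) μ := by
    refine hint.mono' (by fun_prop) (.of_forall fun ω => ?_)
    rw [Real.norm_eq_abs, Real.abs_exp, Real.exp_le_exp]
    linarith [le_abs_self (t * Y ω), hle ω, hY0 ω]
  have hfac : ∀ ω, Real.exp (t * (Y ω - 1)) = Real.exp (-t) * Real.exp (t * Y ω) := fun ω => by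
    rw [← Real.exp_add]; ring_nf
  refine ⟨by simpa only [hfac] using hti.const_mul _, ?_⟩
  have hpt : ∀ ω, Real.exp (t * Y ω) ≤ 1 + t * Y ω + 512 * t ^ 2 * Real.exp (Y ω / 8) := by
    intro ω
    have h1 := Real.exp_le_one_add_add_sq_mul_exp_abs (t * Y ω)
    have h2 : Real.exp |t * Y ω| ≤ Real.exp (Y ω / 16) := Real.exp_le_exp.mpr (hle ω)
    have h3 : Y ω ^ 2 ≤ 512 * Real.exp (Y ω / 16) := by
      have := Real.quadratic_le_exp_of_nonneg (x := Y ω / 16) (by linarith [hY0 ω])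
      nlinarith [hY0 ω]
    have h4 : Real.exp (Y ω / 8) = Real.exp (Y ω / 16) * Real.exp (Y ω / 16) := by
      rw [← Real.exp_add]; ring_nf
    have h5 : (t * Y ω) ^ 2 * Real.exp |t * Y ω| ≤
        (t ^ 2 * (512 * Real.exp (Y ω / 16))) * Real.exp (Y ω / 16) := by
      rw [mul_pow]
      gcongr
    rw [h4]
    linarith
  have hI : ∫ ω, Real.exp (t * Y ω) ∂μ ≤ 1 + t + 2048 * t ^ 2 := by
    have hA : Integrable (fun ω => 1 + t * Y ω) μ := (integrable_const _).add (hYi.const_mul t)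
    have hB : Integrable (fun ω => 512 * t ^ 2 * Real.exp (Y ω / 8)) μ := hint.const_mul _
    refine (integral_mono hti (hA.add hB) hpt).trans ?_
    simp only [Pi.add_apply]
    rw [integral_add hA hB, integral_add (integrable_const _) (hYi.const_mul t),
      integral_const_mul, integral_const_mul, hmean]
    simp only [integral_const, probReal_univ, smul_eq_mul]
    nlinarith [sq_nonneg t]
  rw [mgf]
  simp only [hfac]
  rw [integral_const_mul]
  calc Real.exp (-t) * ∫ ω, Real.exp (t * Y ω) ∂μ
      ≤ Real.exp (-t) * Real.exp (t + 2048 * t ^ 2) := by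
        gcongr
        linarith [Real.add_one_le_exp (t + 2048 * t ^ 2)]
    _ = Real.exp (2048 * t ^ 2) := by rw [← Real.exp_add]; ring_nf

/-- A Bernstein inequality, in the regime where the deviation is Gaussian: the average of
independent copies of a nonnegative variable with mean `1` and an exponential moment. -/
theorem measure_pi_sum_sub_card_le {Ω : Type*} [MeasurableSpace Ω] {μ : Measure Ω}
    [IsProbabilityMeasure μ] {Y : Ω → ℝ} (hYm : Measurable Y) (hY0 : ∀ ω, 0 ≤ Y ω)
    (hint : Integrable (fun ω => Real.exp (Y ω / 8)) μ) (hexp : ∫ ω, Real.exp (Y ω / 8) ∂μ ≤ 4)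
    (hmean : ∫ ω, Y ω ∂μ = 1) (D : ℕ) {ε : ℝ} (hε0 : 0 ≤ ε) (hε1 : ε ≤ 1) :
    (Measure.pi fun _ : Fin D => μ).real {ω | ε * D ≤ |∑ k, Y (ω k) - D|} ≤
      2 * Real.exp (-(D * ε ^ 2) / 8192) := by
  set P := Measure.pi fun _ : Fin D => μ
  set S : (Fin D → Ω) → ℝ := fun ω => ∑ k, (Y (ω k) - 1) with hS
  have hSe : ∀ ω, ∑ k, Y (ω k) - D = S ω := fun ω => by simp [hS]
  have hfac : ∀ (t : ℝ) (ω : Fin D → Ω),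
      Real.exp (t * S ω) = ∏ k, Real.exp (t * (Y (ω k) - 1)) := fun t ω => by
    rw [← Real.exp_sum, hS, Finset.mul_sum]
  have hmgf : ∀ t : ℝ, |t| ≤ 1 / 16 → Integrable (fun ω => Real.exp (t * S ω)) P ∧
      mgf S P t ≤ Real.exp (2048 * D * t ^ 2) := by
    intro t ht
    obtain ⟨h1, h2⟩ := mgf_sub_one_le hYm hY0 hint hexp hmean ht
    constructor
    · simp only [hfac]
      exact Integrable.fintype_prod (f := fun _ ω => Real.exp (t * (Y ω - 1))) fun _ => h1
    · rw [mgf]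
      simp only [hfac]
      rw [integral_fintype_prod_eq_pow (fun ω => Real.exp (t * (Y ω - 1))), Fintype.card_fin]
      calc _ ≤ Real.exp (2048 * t ^ 2) ^ D :=
            pow_le_pow_left₀ (integral_nonneg fun _ => (Real.exp_pos _).le) h2 D
        _ = _ := by rw [← Real.exp_nat_mul]; ring_nf
  -- the minimizer of `- t ε + 2048 t²`
  have ht : |ε / 4096| ≤ 1 / 16 := by rw [abs_of_nonneg (by positivity)]; linarith
  obtain ⟨hi1, hm1⟩ := hmgf (ε / 4096) ht
  obtain ⟨hi2, hm2⟩ := hmgf (-(ε / 4096)) (by rwa [abs_neg])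
  have hup := measure_ge_le_exp_mul_mgf (μ := P) (X := S) (ε * D) (by positivity) hi1
  have hlo := measure_le_le_exp_mul_mgf (μ := P) (X := S) (-(ε * D))
    (neg_nonpos.mpr (by positivity)) hi2
  have hval : Real.exp (-(ε / 4096) * (ε * D)) * Real.exp (2048 * D * (ε / 4096) ^ 2) =
      Real.exp (-(D * ε ^ 2) / 8192) := by
    rw [← Real.exp_add]; ring_nf
  have hup' := hup.trans ((mul_le_mul_of_nonneg_left hm1 (Real.exp_pos _).le).trans_eq hval)
  have hlo' : P.real {ω | S ω ≤ -(ε * D)} ≤ Real.exp (-(D * ε ^ 2) / 8192) := by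
    refine hlo.trans ((mul_le_mul_of_nonneg_left hm2 (Real.exp_pos _).le).trans_eq ?_)
    rw [← hval]; ring_nf
  calc P.real {ω | ε * D ≤ |∑ k, Y (ω k) - D|}
      ≤ P.real ({ω | ε * D ≤ S ω} ∪ {ω | S ω ≤ -(ε * D)}) := by
        refine measureReal_mono fun ω hω => ?_
        simp only [Set.mem_ofPred_eq, hSe] at hω
        rcases le_abs.mp hω with h | h
        · exact Or.inl h
        · exact Or.inr (by simp only [Set.mem_ofPred_eq]; linarith)
    _ ≤ _ := (measureReal_union_le _ _).trans (by linarith)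

/-! ### Moments of the squared feature distance -/

theorem integral_exp_sq_gaussianReal {v : NNReal} (hv : v ≠ 0) :
    Integrable (fun g : ℝ => Real.exp (g ^ 2 / (4 * v))) (gaussianReal 0 v) ∧
      ∫ g, Real.exp (g ^ 2 / (4 * v)) ∂gaussianReal 0 v = Real.sqrt 2 := by
  have hv' : (0 : ℝ) < v := by positivity
  have e : ∀ g : ℝ, gaussianPDFReal 0 v g • Real.exp (g ^ 2 / (4 * v)) =
      (Real.sqrt (2 * Real.pi * v))⁻¹ * Real.exp (-(4 * v : ℝ)⁻¹ * g ^ 2) := by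
    intro g
    rw [gaussianPDFReal_def, smul_eq_mul, mul_assoc, ← Real.exp_add]
    congr 2
    field_simp
    ring
  constructor
  · rw [gaussianReal_of_var_ne_zero _ hv, integrable_withDensity_iff_integrable_smul'
      (measurable_gaussianPDF 0 v) (.of_forall fun _ => gaussianPDF_lt_top)]
    simp only [toReal_gaussianPDF, e]
    exact (integrable_exp_neg_mul_sq (by positivity)).const_mul _
  · rw [integral_gaussianReal_eq_integral_smul hv]
    simp only [e]
    rw [integral_const_mul, integral_gaussian, ← Real.sqrt_inv, ← Real.sqrt_mul (by positivity)]
    congr 1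
    have := Real.pi_pos
    field_simp
    norm_num

variable {c : ℝ} {ι : Type*} [Fintype ι]

/-- The mean of half the squared feature distance is half the squared kernel distance. -/
theorem integral_one_sub_cos_inner (hc : 0 < c) (z : EuclideanSpace ℝ ι) :
    ∫ ω, (1 - Real.cos (inner ℝ ω z)) ∂rffMeasure (gaussianKernel c ι) =
      1 - gaussianKernel c ι z := by
  have := isProbabilityMeasure_rffMeasure_gaussianKernel hc ι
  have h := congrArg Complex.re (charFun_rffMeasure_gaussianKernel hc z)
  have hi : Integrable (fun ω : EuclideanSpace ℝ ι => Complex.exp ((inner ℝ ω z : ℝ) * Complex.I))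
      (rffMeasure (gaussianKernel c ι)) :=
    (integrable_const (1 : ℝ)).mono' (by fun_prop)
      (.of_forall fun ω => by rw [Complex.norm_exp_ofReal_mul_I])
  have hre : ∀ ω : EuclideanSpace ℝ ι,
      RCLike.re (Complex.exp ((inner ℝ ω z : ℝ) * Complex.I)) = Real.cos (inner ℝ ω z) :=
    fun ω => Complex.exp_ofReal_mul_I_re _
  have hcos : Integrable (fun ω : EuclideanSpace ℝ ι => Real.cos (inner ℝ ω z))
      (rffMeasure (gaussianKernel c ι)) := by
    simpa only [hre] using hi.re
  rw [integral_sub (integrable_const _) hcos]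
  rw [charFun_apply] at h
  have h2 := integral_re hi
  simp only [hre] at h2
  rw [h2]
  simp only [integral_const, probReal_univ, smul_eq_mul, mul_one]
  congr 1
  refine h.trans ?_
  rw [← Complex.ofReal_neg, ← Complex.ofReal_exp, Complex.ofReal_re, gaussianKernel, neg_div]

/-- Relative to its mean `1 - exp (-s)`, half the squared feature distance `1 - cos g` is
dominated by a constant plus the square of the normalized phase, uniformly in the distance `s`: for
large `s` the numerator is at most `2` and the mean is bounded below, while for small `s` the
numerator is at most `g² / 2` and the mean is of order `s`. -/
theorem one_sub_cos_div_le {s g : ℝ} (hs : 0 < s) :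
    (1 - Real.cos g) / (1 - Real.exp (-s)) ≤ 4 + g ^ 2 / s := by
  have hexp : Real.exp (-s) ≤ 1 / (1 + s) := by
    rw [Real.exp_neg, inv_eq_one_div]
    exact one_div_le_one_div_of_le (by linarith) (by linarith [Real.add_one_le_exp s])
  have hμ : s / (1 + s) ≤ 1 - Real.exp (-s) := by
    have : s / (1 + s) = 1 - 1 / (1 + s) := by field_simp; ring
    linarith
  have hμ0 : 0 < s / (1 + s) := by positivity
  have h0 : 0 ≤ 1 - Real.cos g := by linarith [Real.cos_le_one g]
  have h1 := Real.one_sub_sq_div_two_le_cos (x := g)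
  have h2 := Real.neg_one_le_cos g
  calc (1 - Real.cos g) / (1 - Real.exp (-s))
      ≤ (1 - Real.cos g) / (s / (1 + s)) := by gcongr
    _ = (1 - Real.cos g) + (1 - Real.cos g) / s := by field_simp; ring
    _ ≤ 4 + g ^ 2 / s := by
        gcongr
        · linarith
        · nlinarith [sq_nonneg g]

theorem integral_exp_one_sub_cos_inner_le (hc : 0 < c) {z : EuclideanSpace ℝ ι} (hz : z ≠ 0) :
    Integrable (fun ω => Real.exp
        ((1 - Real.cos (inner ℝ ω z)) / (1 - gaussianKernel c ι z) / 8))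
        (rffMeasure (gaussianKernel c ι)) ∧
      ∫ ω, Real.exp ((1 - Real.cos (inner ℝ ω z)) / (1 - gaussianKernel c ι z) / 8)
        ∂rffMeasure (gaussianKernel c ι) ≤ 4 := by
  have hz' : 0 < ‖z‖ := norm_pos_iff.mpr hz
  have hs : 0 < ‖z‖ ^ 2 / c := by positivity
  set v : NNReal := (2 * ‖z‖ ^ 2 / c).toNNReal with hv
  have hvr : (v : ℝ) = 2 * (‖z‖ ^ 2 / c) := by
    rw [hv, Real.coe_toNNReal _ (by positivity)]; ring
  have hv0 : v ≠ 0 := by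
    intro h
    rw [h, NNReal.coe_zero] at hvr
    linarith
  obtain ⟨hi, hI⟩ := integral_exp_sq_gaussianReal hv0
  have hmap := map_inner_rffMeasure_gaussianKernel hc z
  rw [← hv] at hmap
  rw [← hmap] at hi hI
  rw [integrable_map_measure (by fun_prop) (by fun_prop)] at hi
  rw [integral_map (by fun_prop) (by fun_prop)] at hI
  have hpt : ∀ ω : EuclideanSpace ℝ ι,
      Real.exp ((1 - Real.cos (inner ℝ ω z)) / (1 - gaussianKernel c ι z) / 8) ≤
        Real.exp (1 / 2) * Real.exp ((inner ℝ ω z : ℝ) ^ 2 / (4 * v)) := by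
    intro ω
    have h := one_sub_cos_div_le (g := inner ℝ ω z) hs
    rw [gaussianKernel, neg_div, ← Real.exp_add, Real.exp_le_exp, hvr]
    have e : (inner ℝ ω z : ℝ) ^ 2 / (4 * (2 * (‖z‖ ^ 2 / c))) =
        (inner ℝ ω z : ℝ) ^ 2 / (‖z‖ ^ 2 / c) / 8 := by
      field_simp
      ring
    rw [e]
    linarith
  have hint : Integrable (fun ω => Real.exp
      ((1 - Real.cos (inner ℝ ω z)) / (1 - gaussianKernel c ι z) / 8))
      (rffMeasure (gaussianKernel c ι)) :=
    (hi.const_mul (Real.exp (1 / 2))).mono' (by fun_prop) (.of_forall fun ω => by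
      rw [Real.norm_eq_abs, Real.abs_exp]; exact hpt ω)
  refine ⟨hint, (integral_mono hint (hi.const_mul (Real.exp (1 / 2))) hpt).trans ?_⟩
  simp only [Function.comp_apply]
  rw [integral_const_mul, hI]
  have h1 : Real.exp (1 / 2) ≤ 2 := by
    have h := Real.exp_bound_div_one_sub_of_interval (x := 1 / 2) (by norm_num) (by norm_num)
    norm_num at h ⊢
    exact h
  have h2 : Real.sqrt 2 ≤ 2 := by
    rw [Real.sqrt_le_left (by norm_num)]; norm_num
  nlinarith [Real.sqrt_nonneg 2, Real.exp_pos (1 / 2)]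

end Concentration

/-! ### Execution within a time bound -/

namespace RealRAM

/-- Started in `s`, the program `P` halts within `T` steps in a state satisfying `Q`. -/
def RunsWithin (P : Cmd) (s : State) (T : ℕ) (Q : State → Prop) : Prop :=
  ∃ t s', Exec P s t s' ∧ t ≤ T ∧ Q s'

theorem RunsWithin.mono {P : Cmd} {s : State} {T T' : ℕ} {Q Q' : State → Prop}
    (h : RunsWithin P s T Q) (hT : T ≤ T') (hQ : ∀ s', Q s' → Q' s') : RunsWithin P s T' Q' := by
  obtain ⟨t, s', he, ht, hq⟩ := h
  exact ⟨t, s', he, ht.trans hT, hQ _ hq⟩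

theorem RunsWithin.seq {P P' : Cmd} {s : State} {T T' : ℕ} {Q Q' : State → Prop}
    (h : RunsWithin P s T Q) (h' : ∀ s', Q s' → RunsWithin P' s' T' Q') :
    RunsWithin (.seq P P') s (T + T') Q' := by
  obtain ⟨t, s', he, ht, hq⟩ := h
  obtain ⟨t', s'', he', ht', hq'⟩ := h' s' hq
  exact ⟨t + t', s'', .seq he he', by omega, hq'⟩

/-- The sequential composition of a list of instructions. -/
def block : List Instr → Cmd
  | [] => .nop
  | I :: l => .seq (.instr I) (block l)

theorem runsWithin_block (l : List Instr) (s : State) {Q : State → Prop}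
    (hQ : Q (l.foldl (fun s I => I.apply s) s)) : RunsWithin (block l) s (l.length + 1) Q := by
  induction l generalizing s with
  | nil => exact ⟨1, s, .nop s, le_rfl, hQ⟩
  | cons I l ih =>
    obtain ⟨t, s', he, ht, hq⟩ := ih (I.apply s) hQ
    exact ⟨1 + t, s', .seq (.instr I s) he, by simp only [List.length_cons]; omega, hq⟩

theorem RunsWithin.cond {b : Test} {P P' : Cmd} {s : State} {T : ℕ} {Q : State → Prop}
    (h : b.Holds s → RunsWithin P s T Q) (h' : ¬ b.Holds s → RunsWithin P' s T Q) :
    RunsWithin (.cond b P P') s (T + 1) Q := by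
  by_cases hb : b.Holds s
  · obtain ⟨t, s', he, ht, hq⟩ := h hb
    exact ⟨t + 1, s', .condTrue hb he, by omega, hq⟩
  · obtain ⟨t, s', he, ht, hq⟩ := h' hb
    exact ⟨t + 1, s', .condFalse hb he, by omega, hq⟩

/-- The rule for a loop whose test holds `n` times: `Inv m` is what is known after `m` rounds. -/
theorem RunsWithin.loop {b : Test} {P : Cmd} {n T : ℕ} (Inv : ℕ → State → Prop)
    (hstep : ∀ m < n, ∀ s, Inv m s → b.Holds s ∧ RunsWithin P s T (Inv (m + 1)))
    (hend : ∀ s, Inv n s → ¬ b.Holds s) {s : State} (h0 : Inv 0 s) :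
    RunsWithin (.loop b P) s (n * (T + 1) + 1) (Inv n) := by
  suffices H : ∀ r m, m + r = n → ∀ s, Inv m s →
      RunsWithin (.loop b P) s (r * (T + 1) + 1) (Inv n) from H n 0 (by simp) s h0
  intro r
  induction r with
  | zero =>
    rintro m rfl s hs
    exact ⟨1, s, .loopFalse (hend s hs), by simp, hs⟩
  | succ r ih =>
    intro m hm s hs
    obtain ⟨hb, t, s', he, ht, hs'⟩ := hstep m (by omega) s hs
    obtain ⟨t', s'', he', ht', hq⟩ := ih (m + 1) (by omega) s' hs'
    exact ⟨t + t' + 1, s'', .loopTrue hb he he', by rw [Nat.succ_mul]; omega, hq⟩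

/-! ### A program for the map -/

/-- One step of the inner product of a frequency with a unary code. Natural register 6 addresses
the current entry of the frequency; real register 3 holds the position within the block, real
register 4 the coordinate of the point, and the sum is accumulated in real register 0. -/
def entryBody : Cmd :=
  .seq (block [.realAdd 3 3 2, .load 5 1 6, .natSucc 6, .natSucc 5])
    (.cond (.realLe 3 4) (block [.realAdd 0 0 5]) (block []))

/-- The contribution of the block of one coordinate to the inner product. -/
def coordBody : Cmd :=
  .seq (block [.load 4 0 4, .realConst 3 0, .natConst 5 0])
    (.seq (.loop (.natLt 5 2) entryBody) (block [.natSucc 4]))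

/-- The two features of one frequency. Real register 1 holds the factor `√(1/D)` and natural
register 7 the address of the next output cell. -/
def freqBody : Cmd :=
  .seq (block [.realConst 0 0, .natConst 4 0])
    (.seq (.loop (.natLt 4 0) coordBody)
      (block [.realSin 5 0, .realMul 5 1 5, .store 2 7 5, .natSucc 7,
        .realCos 5 0, .realMul 5 1 5, .store 2 7 5, .natSucc 7, .natSucc 3]))

/-- The program: it first converts `D` to a real number by counting. -/
def laplacianProg : Cmd :=
  .seq (block [.natConst 3 0, .natConst 6 0, .natConst 7 0, .realConst 1 0, .realConst 2 1])
    (.seq (.loop (.natLt 3 1) (block [.realAdd 1 1 2, .natSucc 3]))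
      (.seq (block [.natConst 3 0, .realDiv 1 2 1, .realSqrt 1 1])
        (.loop (.natLt 3 1) freqBody)))

/-- The contribution of the first `n` positions of a block to the inner product, where the entries
of the frequency are read from `w` and the coordinate of the point is `ξ`. -/
noncomputable def entrySum (w : ℕ → ℝ) (ξ : ℝ) (n : ℕ) : ℝ :=
  ∑ j ∈ Finset.range n, if (j : ℝ) + 1 ≤ ξ then w j else 0

/-- The contribution of the first `n` blocks of length `N` to the inner product. -/
noncomputable def coordSum (N : ℕ) (w X : ℕ → ℝ) (n : ℕ) : ℝ :=
  ∑ i ∈ Finset.range n, entrySum (fun j => w (i * N + j)) (X i) N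

/-- What stays fixed in the main part of the program: the parameters, the point `X`, the
frequencies `W`, and the normalizing factor. -/
structure Fixed (d D N : ℕ) (X W : ℕ → ℝ) (s : State) : Prop where
  nat0 : s.nat 0 = d
  nat1 : s.nat 1 = D
  nat2 : s.nat 2 = N
  real1 : s.real 1 = Real.sqrt (1 / D)
  real2 : s.real 2 = 1
  arr0 : s.arr 0 = X
  arr1 : s.arr 1 = W

/-- The output cells of the frequencies before the `k`-th one have been filled. -/
def Filled (d D N : ℕ) (X W : ℕ → ℝ) (k : ℕ) (s : State) : Prop :=
  ∀ k' < k,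
    s.arr 2 (2 * k') =
        Real.sqrt (1 / D) * Real.sin (coordSum N (fun p => W (k' * d * N + p)) X d) ∧
      s.arr 2 (2 * k' + 1) =
        Real.sqrt (1 / D) * Real.cos (coordSum N (fun p => W (k' * d * N + p)) X d)

variable {d D N : ℕ} {X W : ℕ → ℝ}

/-- The state during the `k`-th frequency and the `i`-th block, after `j` positions; `acc` is the
contribution of the preceding blocks to the inner product. -/
structure EntryInv (d D N : ℕ) (X W : ℕ → ℝ) (k i : ℕ) (acc : ℝ) (j : ℕ) (s : State) : Prop
    extends Fixed d D N X W s where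
  nat3 : s.nat 3 = k
  nat4 : s.nat 4 = i
  nat5 : s.nat 5 = j
  nat6 : s.nat 6 = k * d * N + (i * N + j)
  nat7 : s.nat 7 = 2 * k
  real3 : s.real 3 = j
  real4 : s.real 4 = X i
  real0 : s.real 0 = acc + entrySum (fun j => W (k * d * N + (i * N + j))) (X i) j
  filled : Filled d D N X W k s

/-- The state during the `k`-th frequency, after `i` blocks. -/
structure CoordInv (d D N : ℕ) (X W : ℕ → ℝ) (k i : ℕ) (s : State) : Prop
    extends Fixed d D N X W s where
  nat3 : s.nat 3 = k
  nat4 : s.nat 4 = i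
  nat6 : s.nat 6 = k * d * N + i * N
  nat7 : s.nat 7 = 2 * k
  real0 : s.real 0 = coordSum N (fun p => W (k * d * N + p)) X i
  filled : Filled d D N X W k s

/-- The state after `k` frequencies. -/
structure FreqInv (d D N : ℕ) (X W : ℕ → ℝ) (k : ℕ) (s : State) : Prop
    extends Fixed d D N X W s where
  nat3 : s.nat 3 = k
  nat6 : s.nat 6 = k * d * N
  nat7 : s.nat 7 = 2 * k
  filled : Filled d D N X W k s

theorem runsWithin_entryBody {k i j : ℕ} {acc : ℝ} {s : State}
    (h : EntryInv d D N X W k i acc j s) :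
    RunsWithin entryBody s 8 (EntryInv d D N X W k i acc (j + 1)) := by
  obtain ⟨⟨h0, h1, h2, hr1, hr2, ha0, ha1⟩, h3, h4, h5, h6, h7, hr3, hr4, hr0, hf⟩ := h
  refine RunsWithin.seq (T := 5) (T' := 3) (runsWithin_block _ s (Q := fun s' => s' = _) rfl) ?_
  rintro s' rfl
  refine RunsWithin.cond (T := 2) (fun hb => (runsWithin_block _ _ ?_)) fun hb =>
    (runsWithin_block _ _ ?_).mono (T' := 2) (by simp) fun _ h => h
  all_goals
    simp only [Test.Holds, List.foldl_cons, List.foldl_nil, Instr.apply, State.setNat,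
      State.setReal] at hb ⊢
    simp [hr3, hr4, hr2] at hb
    refine ⟨⟨?_, ?_, ?_, ?_, ?_, ?_, ?_⟩, ?_, ?_, ?_, ?_, ?_, ?_, ?_, ?_, ?_⟩
  all_goals first
    | exact hf
    | (simp [h0, h1, h2, hr1, hr2, ha0, ha1, h3, h4, h5, h6, h7, hr3, hr4]; done)
    | (simp [h6]; ring1)
    | skip
  · simp [hr0, ha1, h6, entrySum, Finset.sum_range_succ, hb]
    ring
  · simp [hr0, entrySum, Finset.sum_range_succ, not_le.mpr hb]

theorem runsWithin_coordBody {k i : ℕ} {s : State} (h : CoordInv d D N X W k i s) :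
    RunsWithin coordBody s (4 + ((N * 9 + 1) + 2)) (CoordInv d D N X W k (i + 1)) := by
  obtain ⟨⟨h0, h1, h2, hr1, hr2, ha0, ha1⟩, h3, h4, h6, h7, hr0, hf⟩ := h
  refine RunsWithin.seq (T := 4)
    (Q := EntryInv d D N X W k i (coordSum N (fun p => W (k * d * N + p)) X i) 0)
    (runsWithin_block _ s ?_) fun s hs => RunsWithin.seq
      (RunsWithin.loop (b := .natLt 5 2) (n := N) (T := 8)
        (EntryInv d D N X W k i (coordSum N (fun p => W (k * d * N + p)) X i)) ?_ ?_ hs) ?_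
  · simp only [List.foldl_cons, List.foldl_nil, Instr.apply, State.setNat, State.setReal]
    refine ⟨⟨?_, ?_, ?_, ?_, ?_, ?_, ?_⟩, ?_, ?_, ?_, ?_, ?_, ?_, ?_, ?_, ?_⟩
    all_goals first
      | exact hf
      | simp [h0, h1, h2, hr1, hr2, ha0, ha1, h3, h4, h6, h7, hr0, entrySum]
  · intro m hm s hs
    exact ⟨by simpa [Test.Holds, hs.nat5, hs.nat2] using hm, runsWithin_entryBody hs⟩
  · intro s hs
    simp [Test.Holds, hs.nat5, hs.nat2]
  · rintro s ⟨⟨h0, h1, h2, hr1, hr2, ha0, ha1⟩, h3, h4, h5, h6, h7, hr3, hr4, hr0, hf⟩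
    refine runsWithin_block _ _ ?_
    simp only [List.foldl_cons, List.foldl_nil, Instr.apply, State.setNat]
    refine ⟨⟨?_, ?_, ?_, ?_, ?_, ?_, ?_⟩, ?_, ?_, ?_, ?_, ?_, ?_⟩
    all_goals first
      | exact hf
      | (simp [h0, h1, h2, hr1, hr2, ha0, ha1, h3, h4, h6, h7, hr0, coordSum,
          Finset.sum_range_succ]; done)
      | (simp [h6]; ring1)

theorem runsWithin_freqBody {k : ℕ} {s : State} (h : FreqInv d D N X W k s) :
    RunsWithin freqBody s (3 + ((d * ((4 + ((N * 9 + 1) + 2)) + 1) + 1) + 10))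
      (FreqInv d D N X W (k + 1)) := by
  obtain ⟨⟨h0, h1, h2, hr1, hr2, ha0, ha1⟩, h3, h6, h7, hf⟩ := h
  refine RunsWithin.seq (T := 3) (Q := CoordInv d D N X W k 0)
    (runsWithin_block _ s ?_) fun s hs => RunsWithin.seq
      (RunsWithin.loop (b := .natLt 4 0) (n := d) (CoordInv d D N X W k) ?_ ?_ hs) ?_
  · simp only [List.foldl_cons, List.foldl_nil, Instr.apply, State.setNat, State.setReal]
    refine ⟨⟨?_, ?_, ?_, ?_, ?_, ?_, ?_⟩, ?_, ?_, ?_, ?_, ?_, ?_⟩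
    all_goals first
      | exact hf
      | simp [h0, h1, h2, hr1, hr2, ha0, ha1, h3, h6, h7, coordSum]
  · intro m hm s hs
    exact ⟨by simpa [Test.Holds, hs.nat4, hs.nat0] using hm, runsWithin_coordBody hs⟩
  · intro s hs
    simp [Test.Holds, hs.nat4, hs.nat0]
  · rintro s ⟨⟨h0, h1, h2, hr1, hr2, ha0, ha1⟩, h3, h4, h6, h7, hr0, hf⟩
    refine runsWithin_block _ _ ?_
    simp only [List.foldl_cons, List.foldl_nil, Instr.apply, State.setNat, State.setReal,
      State.setArr]
    refine ⟨⟨?_, ?_, ?_, ?_, ?_, ?_, ?_⟩, ?_, ?_, ?_, ?_⟩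
    all_goals first
      | (simp [h0, h1, h2, hr1, hr2, ha0, ha1, h3, h6, h7]; done)
      | (simp [h6, h7]; ring1)
      | skip
    intro k' hk'
    rcases Nat.lt_succ_iff_lt_or_eq.mp hk' with hlt | rfl
    · have e1 : 2 * k' ≠ 2 * k + 1 := by omega
      have e2 : 2 * k' ≠ 2 * k := by omega
      have e3 : 2 * k' + 1 ≠ 2 * k := by omega
      simpa [h7, e1, e2, e3, hlt.ne] using hf k' hlt
    · simp [h7, hr1, hr0]

/-- The time bound is kept in the nested form in which the loops produce it; it is `O(d D N)` when
the parameters are positive. -/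
theorem runsWithin_laplacianProg {s : State} (h0 : s.nat 0 = d) (h1 : s.nat 1 = D)
    (h2 : s.nat 2 = N) :
    RunsWithin laplacianProg s
      (6 + ((D * 4 + 1) +
        (4 + (D * ((3 + ((d * ((4 + ((N * 9 + 1) + 2)) + 1) + 1) + 10)) + 1) + 1))))
      (FreqInv d D N (s.arr 0) (s.arr 1) D) := by
  refine RunsWithin.seq (T := 6) (runsWithin_block _ s (Q := fun s' => s' = _) rfl)
    fun s' hs' => RunsWithin.seq (RunsWithin.loop (b := .natLt 3 1) (n := D) (T := 3)
      (fun m t => t.nat 0 = d ∧ t.nat 1 = D ∧ t.nat 2 = N ∧ t.nat 3 = m ∧ t.nat 6 = 0 ∧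
        t.nat 7 = 0 ∧ t.real 1 = m ∧ t.real 2 = 1 ∧ t.arr = s.arr) ?_ ?_ ?_)
        fun s' hs' => RunsWithin.seq (T := 4) (Q := FreqInv d D N (s.arr 0) (s.arr 1) 0)
          (runsWithin_block _ _ ?_) fun s' hs' => RunsWithin.loop (b := .natLt 3 1) (n := D)
            (FreqInv d D N (s.arr 0) (s.arr 1)) ?_ ?_ hs'
  · rintro m hm t ⟨e0, e1, e2, e3, e6, e7, r1, r2, ea⟩
    refine ⟨by simpa [Test.Holds, e3, e1] using hm, runsWithin_block _ _ ?_⟩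
    simp [Instr.apply, State.setNat, State.setReal, *]
  · rintro t ⟨e0, e1, e2, e3, e6, e7, r1, r2, ea⟩
    simp [Test.Holds, e3, e1]
  · subst hs'
    simp [Instr.apply, State.setNat, State.setReal, *]
  · obtain ⟨e0, e1, e2, e3, e6, e7, r1, r2, ea⟩ := hs'
    simp only [List.foldl_cons, List.foldl_nil, Instr.apply, State.setNat, State.setReal]
    refine ⟨⟨?_, ?_, ?_, ?_, ?_, ?_, ?_⟩, ?_, ?_, ?_, fun k' hk' => absurd hk' (by simp)⟩
    all_goals simp [*]
  · intro m hm t ht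
    exact ⟨by simpa [Test.Holds, ht.nat3, ht.nat1] using hm, runsWithin_freqBody ht⟩
  · intro t ht
    simp [Test.Holds, ht.nat3, ht.nat1]

end RealRAM

/-- The nested sums computed by the program are the inner product with the unary embedding. -/
theorem coordSum_eq_inner_unaryEmbedding {d N : ℕ} (ω : EuclideanSpace ℝ (Fin d × Fin N))
    (x : Fin d → ℝ) (w X : ℕ → ℝ) (hw : ∀ (i : Fin d) (j : Fin N), w (i * N + j) = ω (i, j))
    (hX : ∀ i : Fin d, X i = x i) :
    RealRAM.coordSum N w X d = inner ℝ ω (unaryEmbedding N x) := by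
  simp only [RealRAM.coordSum, RealRAM.entrySum, Finset.sum_range, hw, hX, PiLp.inner_apply,
    Fintype.sum_prod_type, unaryEmbedding]
  refine Finset.sum_congr rfl fun i _ => Finset.sum_congr rfl fun j _ => ?_
  split_ifs <;> simp

theorem exists_exec_laplacianProg {d D N : ℕ} (hd : 0 < d) (hD : 0 < D) (hN : 0 < N)
    (ω : Fin D → EuclideanSpace ℝ (Fin d × Fin N)) (x : Fin d → ℝ) (s : RealRAM.State)
    (hs : IsInputState ω x s) :
    ∃ (t : ℕ) (s' : RealRAM.State), RealRAM.Exec RealRAM.laplacianProg s t s' ∧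
      IsOutputState (laplacianMap ω x) s' ∧ t ≤ 60 * (d * D * N) := by
  obtain ⟨h0, h1, h2, hX, hW⟩ := hs
  obtain ⟨t, s', he, ht, hq⟩ := RealRAM.runsWithin_laplacianProg h0 h1 h2
  refine ⟨t, s', he, fun k b => ?_, ht.trans ?_⟩
  · have hsum := coordSum_eq_inner_unaryEmbedding (ω k) x
      (fun p => s.arr 1 (k * d * N + p)) (s.arr 0)
      (fun i j => by rw [← hW k i j]; congr 1; ring) hX
    obtain ⟨ha, hb⟩ := hq.filled k k.isLt
    rw [hsum] at ha hb
    fin_cases b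
    · simpa [laplacianMap, rffMap] using ha
    · simpa [laplacianMap, rffMap] using hb
  · have e1 : D ≤ d * D * N := by nlinarith [Nat.mul_pos hd hN, Nat.mul_pos hD hN]
    have e2 : d * D ≤ d * D * N := Nat.le_mul_of_pos_right _ hN
    have e3 : 1 ≤ d * D * N := Nat.mul_pos (Nat.mul_pos hd hD) hN
    nlinarith

/-! ### Distances -/

theorem sum_sq_indicator_sub (N a b : ℕ) (ha : a ≤ N) (hb : b ≤ N) :
    ∑ j : Fin N, ((if ((j : ℕ) : ℝ) + 1 ≤ a then (1 : ℝ) else 0) -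
      (if ((j : ℕ) : ℝ) + 1 ≤ b then 1 else 0)) ^ 2 = |(a : ℝ) - b| := by
  wlog hab : a ≤ b generalizing a b
  · rw [abs_sub_comm, ← this b a hb ha (le_of_not_ge hab)]
    exact Finset.sum_congr rfl fun j _ => by ring
  have e : ∀ j : ℕ, ((if (j : ℝ) + 1 ≤ a then (1 : ℝ) else 0) -
      (if (j : ℝ) + 1 ≤ b then 1 else 0)) ^ 2 = if a ≤ j ∧ j < b then 1 else 0 := by
    intro j
    have h1 : (j : ℝ) + 1 ≤ a ↔ j < a := by exact_mod_cast Nat.succ_le_iff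
    have h2 : (j : ℝ) + 1 ≤ b ↔ j < b := by exact_mod_cast Nat.succ_le_iff
    simp only [h1, h2]
    by_cases hja : j < a
    · have : j < b := by omega
      simp [hja, this, not_le.mpr hja]
    · by_cases hjb : j < b <;> simp [hja, hjb, not_lt.mp hja]
  rw [Fin.sum_univ_eq_sum_range (fun j => ((if (j : ℝ) + 1 ≤ a then (1 : ℝ) else 0) -
      (if (j : ℝ) + 1 ≤ b then 1 else 0)) ^ 2)]
  simp only [e]
  have hf : (Finset.range N).filter (fun j => a ≤ j ∧ j < b) = Finset.Ico a b := by
    ext j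
    simp only [Finset.mem_filter, Finset.mem_range, Finset.mem_Ico]
    omega
  rw [Finset.sum_boole, hf, Nat.card_Ico, Nat.cast_sub hab, abs_sub_comm,
    abs_of_nonneg (sub_nonneg.mpr (Nat.cast_le.mpr hab))]

theorem norm_sq_unaryEmbedding_sub {d N : ℕ} (x y : Fin d → ℕ) (hx : ∀ i, x i ≤ N)
    (hy : ∀ i, y i ≤ N) :
    ‖unaryEmbedding N (fun i => (x i : ℝ)) - unaryEmbedding N (fun i => (y i : ℝ))‖ ^ 2 =
      ∑ i, |(x i : ℝ) - (y i : ℝ)| := by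
  rw [EuclideanSpace.norm_sq_eq, Fintype.sum_prod_type]
  refine Finset.sum_congr rfl fun i _ => ?_
  rw [← sum_sq_indicator_sub N (x i) (y i) (hx i) (hy i)]
  refine Finset.sum_congr rfl fun j _ => ?_
  rw [Real.norm_eq_abs, sq_abs]
  simp [unaryEmbedding]

theorem norm_sq_rffMap_sub {ι : Type*} [Fintype ι] {D : ℕ} (ω : Fin D → EuclideanSpace ℝ ι)
    (z z' : EuclideanSpace ℝ ι) :
    ‖rffMap ω z - rffMap ω z'‖ ^ 2 =
      2 / D * ∑ k, (1 - Real.cos (inner ℝ (ω k) (z - z'))) := by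
  rw [EuclideanSpace.norm_sq_eq, Fintype.sum_prod_type, Finset.mul_sum]
  refine Finset.sum_congr rfl fun k _ => ?_
  have h1 : Real.sqrt (1 / D) ^ 2 = 1 / D := Real.sq_sqrt (by positivity)
  have h2 := Real.sin_sq_add_cos_sq (inner ℝ (ω k) z)
  have h3 := Real.sin_sq_add_cos_sq (inner ℝ (ω k) z')
  have h4 : (2 : ℝ) / D = 2 * (1 / D) := by ring
  rw [inner_sub_right, Real.cos_sub, h4, ← h1, Fin.sum_univ_two]
  simp only [rffMap, PiLp.sub_apply, Real.norm_eq_abs, sq_abs, Fin.isValue, if_true,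
    one_ne_zero, if_false]
  linear_combination (Real.sqrt (1 / D) ^ 2) * (h2 + h3)

theorem IsFeatureMap.norm_sq_sub {X H : Type*} [NormedAddCommGroup H] [InnerProductSpace ℝ H]
    {K : X → X → ℝ} {φ : X → H} (h : IsFeatureMap K φ) (x y : X) :
    ‖φ x - φ y‖ ^ 2 = K x x - 2 * K x y + K y y := by
  rw [norm_sub_sq_real, ← real_inner_self_eq_norm_sq, ← real_inner_self_eq_norm_sq, h, h, h]

/-- Squared distances that agree up to a relative error `ε` give distances that do. -/
theorem abs_sub_le_of_abs_sq_sub_sq_le {a b ε : ℝ} (ha : 0 ≤ a) (hb : 0 ≤ b)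
    (h : |a ^ 2 - b ^ 2| ≤ ε * b ^ 2) : |a - b| ≤ ε * b := by
  rcases hb.eq_or_lt with rfl | hb'
  · have : a = 0 := by
      have h0 : a ^ 2 ≤ 0 := by simpa using (le_abs_self _).trans h
      exact pow_eq_zero_iff two_ne_zero |>.mp (le_antisymm h0 (sq_nonneg a))
    simp [this]
  · rw [sq_sub_sq, abs_mul, abs_of_nonneg (by positivity : 0 ≤ a + b)] at h
    refine le_of_mul_le_mul_right ?_ hb'
    nlinarith [mul_nonneg ha (abs_nonneg (a - b))]

/-! ### Preservation of the kernel distance -/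

open MeasureTheory in
/-- A random Fourier feature map of the Gaussian kernel distorts the squared distance of two points
by a relative error above `ε` with a probability bounded independently of the points and of the
dimension. -/
theorem rffLaw_relative_error {c : ℝ} (hc : 0 < c) {ι : Type*} [Fintype ι] {D : ℕ} (hD : 0 < D)
    {ε : ℝ} (hε0 : 0 ≤ ε) (hε1 : ε ≤ 1) (z z' : EuclideanSpace ℝ ι) :
    1 - 2 * Real.exp (-(D * ε ^ 2) / 8192) ≤ (rffLaw (gaussianKernel c ι) D).real
      {ω | |‖rffMap ω z - rffMap ω z'‖ ^ 2 - 2 * (1 - gaussianKernel c ι (z - z'))| ≤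
        ε * (2 * (1 - gaussianKernel c ι (z - z')))} := by
  have hprob := isProbabilityMeasure_rffMeasure_gaussianKernel hc ι
  have : IsProbabilityMeasure (rffLaw (gaussianKernel c ι) D) := by
    rw [rffLaw]; infer_instance
  by_cases hz : z - z' = 0
  · have hset : {ω : Fin D → EuclideanSpace ℝ ι | |‖rffMap ω z - rffMap ω z'‖ ^ 2 -
        2 * (1 - gaussianKernel c ι (z - z'))| ≤
        ε * (2 * (1 - gaussianKernel c ι (z - z')))} = Set.univ := by
      refine Set.eq_univ_of_forall fun ω => ?_
      simp only [Set.mem_ofPred_eq, norm_sq_rffMap_sub, hz]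
      simp [gaussianKernel]
    rw [hset, probReal_univ]
    linarith [Real.exp_pos (-(D * ε ^ 2) / 8192)]
  set κ := gaussianKernel c ι (z - z') with hκ
  have hκ1 : 0 < 1 - κ := by
    have hz' : 0 < ‖z - z'‖ := norm_pos_iff.mpr hz
    have : κ < 1 := by
      rw [hκ, gaussianKernel, Real.exp_lt_one_iff, neg_div, neg_lt_zero]
      positivity
    linarith
  have hD' : (0 : ℝ) < D := Nat.cast_pos.mpr hD
  set Y : EuclideanSpace ℝ ι → ℝ := fun ω => (1 - Real.cos (inner ℝ ω (z - z'))) / (1 - κ) with hY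
  have hmean : ∫ ω, Y ω ∂rffMeasure (gaussianKernel c ι) = 1 := by
    rw [hY, integral_div, integral_one_sub_cos_inner hc, ← hκ, div_self hκ1.ne']
  obtain ⟨hint, hexp⟩ := integral_exp_one_sub_cos_inner_le hc hz
  have htail := measure_pi_sum_sub_card_le (Y := Y) (by fun_prop)
    (fun ω => div_nonneg (by linarith [Real.cos_le_one (inner ℝ ω (z - z'))]) hκ1.le) hint hexp
    hmean D hε0 hε1
  set E := {ω : Fin D → EuclideanSpace ℝ ι |
    |‖rffMap ω z - rffMap ω z'‖ ^ 2 - 2 * (1 - κ)| ≤ ε * (2 * (1 - κ))} with hE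
  have hsub : Eᶜ ⊆ {ω | ε * D ≤ |∑ k, Y (ω k) - D|} := by
    intro ω hω
    simp only [hE, Set.mem_compl_iff, Set.mem_ofPred_eq, not_le] at hω ⊢
    have e : ‖rffMap ω z - rffMap ω z'‖ ^ 2 - 2 * (1 - κ) =
        2 * (1 - κ) / D * (∑ k, Y (ω k) - D) := by
      rw [norm_sq_rffMap_sub, hY]
      simp only [← Finset.sum_div]
      field_simp
    rw [e, abs_mul, abs_of_pos (by positivity)] at hω
    have h2 : ε * (2 * (1 - κ)) = 2 * (1 - κ) / D * (ε * D) := by field_simp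
    rw [h2] at hω
    exact (lt_of_mul_lt_mul_left hω (by positivity)).le
  have hcompl : (rffLaw (gaussianKernel c ι) D).real Eᶜ ≤ 2 * Real.exp (-(D * ε ^ 2) / 8192) :=
    (measureReal_mono hsub).trans htail
  have htot : 1 ≤ (rffLaw (gaussianKernel c ι) D).real E +
      (rffLaw (gaussianKernel c ι) D).real Eᶜ := by
    rw [← probReal_univ (μ := rffLaw (gaussianKernel c ι) D), ← Set.union_compl_self E]
    exact measureReal_union_le _ _
  linarith

theorem two_mul_exp_le_of_log_le {δ M : ℝ} (hδ0 : 0 < δ) (hδ : δ ≤ 1 / 2)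
    (hM : 2 * Real.log (1 / δ) ≤ M) : 2 * Real.exp (-M) ≤ δ := by
  have h : Real.exp (-M) ≤ δ * δ := by
    calc Real.exp (-M) ≤ Real.exp (Real.log δ + Real.log δ) := by
          rw [one_div, Real.log_inv] at hM
          exact Real.exp_le_exp.mpr (by linarith)
      _ = δ * δ := by rw [Real.exp_add, Real.exp_log hδ0]
  nlinarith

theorem theoremF3 :
    ∃ C : ℝ, 0 < C ∧ ∃ (prog : RealRAM.Cmd) (A : ℝ) (a : ℕ),
      ∀ (c ε δ : ℝ) (d D N : ℕ), 0 < c → 0 < δ → δ ≤ ε → ε ≤ (1 / 2) ^ 16 →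
        max (C * ε⁻¹ * Real.log (1 / δ) ^ 3) (C * (ε ^ 2)⁻¹ * Real.log (1 / δ)) ≤ (D : ℝ) →
        -- the frequencies of the Gaussian kernel on `ℝ^(dN)` form a random variable
        MeasureTheory.IsProbabilityMeasure (rffLaw (gaussianKernel c (Fin d × Fin N)) D) ∧
        -- the unary embedding is an isometry from `ℓ₁` to squared `ℓ₂`
        (∀ x y : Fin d → ℕ, (∀ i, x i ≤ N) → (∀ i, y i ≤ N) →
          ‖unaryEmbedding N (fun i => (x i : ℝ)) - unaryEmbedding N (fun i => (y i : ℝ))‖ ^ 2 =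
            ∑ i, |(x i : ℝ) - (y i : ℝ)|) ∧
        -- the composed map preserves the kernel distance
        (∀ (H : Type*) [NormedAddCommGroup H] [InnerProductSpace ℝ H] [CompleteSpace H]
          (φ : (Fin d → ℝ) → H), IsFeatureMap (laplacianKernel c) φ →
          ∀ x y : Fin d → ℕ, (∀ i, x i ≤ N) → (∀ i, y i ≤ N) →
            1 - δ ≤ (rffLaw (gaussianKernel c (Fin d × Fin N)) D).real
              {ω | |‖laplacianMap ω (fun i => (x i : ℝ)) - laplacianMap ω (fun i => (y i : ℝ))‖ -
                    ‖φ (fun i => (x i : ℝ)) - φ (fun i => (y i : ℝ))‖| ≤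
                  ε * ‖φ (fun i => (x i : ℝ)) - φ (fun i => (y i : ℝ))‖}) ∧
        -- the composed map is evaluated in quasilinear time in `d * D * N`
        (0 < d → 0 < N →
          ∀ (ω : Fin D → EuclideanSpace ℝ (Fin d × Fin N)) (x : Fin d → ℝ) (s : RealRAM.State),
            IsInputState ω x s →
            ∃ (t : ℕ) (s' : RealRAM.State), RealRAM.Exec prog s t s' ∧
              IsOutputState (laplacianMap ω x) s' ∧
              (t : ℝ) ≤ A * ((d : ℝ) * D * N) *
                (1 + Real.log ((d : ℝ) * D * N)) ^ a) := by

  -- `2 exp (-D ε² / 8192) ≤ 2 δ² ≤ δ` as soon as `D ε² ≥ 16384 log (1 / δ)`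
  refine ⟨16384, by norm_num, RealRAM.laplacianProg, 60, 0, ?_⟩
  intro c ε δ d D N hc hδ0 hδε hε hD
  have hε0 : 0 < ε := hδ0.trans_le hδε
  have hε1 : ε ≤ 1 / 2 := hε.trans (by norm_num)
  have hδ1 : δ ≤ 1 / 2 := hδε.trans hε1
  have hlog : 0 < Real.log (1 / δ) :=
    Real.log_pos (by rw [lt_div_iff₀ hδ0]; linarith)
  have hD2 : 16384 * (ε ^ 2)⁻¹ * Real.log (1 / δ) ≤ D := (le_max_right _ _).trans hD
  have hDpos : 0 < D := Nat.cast_pos.mp (lt_of_lt_of_le (by positivity) hD2)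
  have hprob := isProbabilityMeasure_rffMeasure_gaussianKernel hc (Fin d × Fin N)
  refine ⟨?_, fun x y hx hy => norm_sq_unaryEmbedding_sub x y hx hy, ?_, ?_⟩
  · rw [rffLaw]
    infer_instance
  · intro H _ _ _ φ hφ x y hx hy
    have hM : 2 * Real.log (1 / δ) ≤ D * ε ^ 2 / 8192 := by
      rw [mul_right_comm, ← div_eq_mul_inv, div_le_iff₀ (by positivity)] at hD2
      linarith
    have hfail := two_mul_exp_le_of_log_le hδ0 hδ1 hM
    have : MeasureTheory.IsProbabilityMeasure
        (rffLaw (gaussianKernel c (Fin d × Fin N)) D) := by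
      rw [rffLaw]; infer_instance
    have hdist : ‖φ (fun i => (x i : ℝ)) - φ (fun i => (y i : ℝ))‖ ^ 2 =
        2 * (1 - gaussianKernel c (Fin d × Fin N)
          (unaryEmbedding N (fun i => (x i : ℝ)) - unaryEmbedding N (fun i => (y i : ℝ)))) := by
      rw [hφ.norm_sq_sub, gaussianKernel, norm_sq_unaryEmbedding_sub x y hx hy]
      simp only [laplacianKernel, sub_self, abs_zero, Finset.sum_const_zero, neg_zero, zero_div,
        Real.exp_zero]
      ring
    have hrel := rffLaw_relative_error hc hDpos hε0.le (by linarith : ε ≤ 1)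
      (unaryEmbedding N fun i => (x i : ℝ)) (unaryEmbedding N fun i => (y i : ℝ))
    rw [neg_div] at hrel
    rw [← hdist] at hrel
    refine (by linarith : 1 - δ ≤ _).trans (hrel.trans (MeasureTheory.measureReal_mono ?_))
    exact fun ω hω => abs_sub_le_of_abs_sq_sub_sq_le (norm_nonneg _) (norm_nonneg _) hω
  · intro hd hN ω x s hs
    obtain ⟨t, s', he, ho, ht⟩ := exists_exec_laplacianProg hd hDpos hN ω x s hs
    refine ⟨t, s', he, ho, ?_⟩
    rw [pow_zero, mul_one]
    exact_mod_cast ht
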